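/- Let $d\ge 1$, $\mathbf n=(n_1,\dots,n_d)\in\mathbb N^d$ (with $0\in\mathbb N$), and let $\boldsymbol U=\{u_{\mathbf k}\in\mathbb N^d:\mathbf k\in\mathbb N^d\}$ be a family of weight vectors, $u_{\mathbf k}=(u_{\mathbf k,1},\dots,u_{\mathbf k,d})$, with $u_{\mathbf k,i}\le u_{\mathbf k',i}$ whenever $\mathbf k\le\mathbf k'$ coordinatewise. A $d$-tuple $(\boldsymbol a^{(1)},\dots,\boldsymbol a^{(d)})$ of sequences $\boldsymbol a^{(i)}=(a^{(i)}_0,\dots,a^{(i)}_{n_i-1})$ of non-negative integers is *bounded by* a lattice path $P$ from the origin to $\mathbf n$ (with unit coordinate steps $\mathbf e_1,\dots,\mathbf e_d$) with respect to $\boldsymbol U$ if $a^{(i)}_{k_i}<u_{\mathbf k,i}$ for every step of $P$ from a point $\mathbf k$ to $\mathbf k+\mathbf e_i$. The tuple is a $d$-dimensional $\boldsymbol U$-parking function if its order statistics (the tuple of the non-decreasing rearrangements of the $\boldsymbol a^{(i)}$) are bounded by some such lattice path, and it is *increasing* if moreover every $\boldsymbol a^{(i)}$ is non-decreasing. Let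 $\mathcal{IPF}^{(d)}_{\mathbf n}(\boldsymbol U)$ be the set of $d$-dimensional increasing $\boldsymbol U$-parking functions. Suppose that $\boldsymbol U=A\,\mathbb N^d+\mathbf s$, i.e. $u_{\mathbf k}=A\mathbf k+\mathbf s$ for all $\mathbf k\in\mathbb N^d$, where $\mathbf s\in\mathbb Z^d$ and $A=(a_{i,j})$ is the $d\times d$ integer matrix with $a_{i,i}=0$ and $a_{i,j}=\alpha_j$ for $i\ne j$. Put $N=\sum_{i=1}^d\alpha_i n_i$ and suppose that $s_j+N\ne 0$ for all $j$. Then the set $\mathcal{IPF}^{(d)}_{\mathbf n}(\boldsymbol U)$ is finite and $$\#\mathcal{IPF}^{(d)}_{\mathbf n}(\boldsymbol U)=\frac1{\mathbf n!}\Bigl(1-\sum_{j=1}^d\frac{\alpha_j n_j}{s_j+N}\Bigr)\prod_{i=1}^d (s_i+N)\,(s_i+N-\alpha_i n_i+1)^{(n_i-1)},$$ where $\mathbf n!=n_1!\cdots n_d!$, $x^{(k)}=x(x+1)\cdots(x+k-1)$ for $k\ge 0$ (so $x^{(0)}=1$), and $x^{(-1)}=1/(x-1)$ (which is needed only for the indices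 $i$ with $n_i=0$). -/

import Mathlib

/-- A lattice path from the origin to `n` in `ℕ^d` with unit coordinate steps, recorded as the list
of the directions of its steps. -/
structure LatticePath {d : ℕ} (n : Fin d → ℕ) where
  steps : List (Fin d)
  count_eq : ∀ i, steps.count i = n i

/-- The lattice point reached after the first `r` steps. -/
def LatticePath.pos {d : ℕ} {n : Fin d → ℕ} (P : LatticePath n) (r : ℕ) : Fin d → ℕ :=
  fun i => (P.steps.take r).count i

theorem LatticePath.pos_lt {d : ℕ} {n : Fin d → ℕ} (P : LatticePath n) (r : ℕ)
    (hr : r < P.steps.length) : P.pos r (P.steps[r]) < n (P.steps[r]) := by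
  have h1 : (P.steps.take (r + 1)).count P.steps[r] ≤ P.steps.count P.steps[r] :=
    (List.take_sublist _ _).count_le _
  rw [List.take_succ_eq_append_getElem hr, List.count_append, P.count_eq] at h1
  have h2 : List.count P.steps[r] [P.steps[r]] = 1 := by simp
  rw [h2] at h1
  exact h1

/-- A `d`-tuple of sequences `a i = (a i 0, …, a i (n i - 1))` is bounded by the path `P` with
respect to the weights `U`: if the `r`-th step of `P` goes from `k` to `k + e_i`, then the entry of
`a i` with index `k i` is smaller than `U k i`. -/
def BoundedBy {d : ℕ} {n : Fin d → ℕ} (U : (Fin d → ℕ) → Fin d → ℕ)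
    (a : ∀ i, Fin (n i) → ℕ) (P : LatticePath n) : Prop :=
  ∀ (r : ℕ) (hr : r < P.steps.length),
    a P.steps[r] ⟨P.pos r P.steps[r], P.pos_lt r hr⟩ < U (P.pos r) P.steps[r]

/-- The order statistics (non-decreasing rearrangement) of a finite sequence. -/
def orderStatistics {m : ℕ} (a : Fin m → ℕ) : Fin m → ℕ :=
  a ∘ Tuple.sort a

/-- `d`-dimensional `U`-parking functions. -/
def IsParkingFunction {d : ℕ} {n : Fin d → ℕ} (U : (Fin d → ℕ) → Fin d → ℕ)
    (a : ∀ i, Fin (n i) → ℕ) : Prop :=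
  ∃ P : LatticePath n, BoundedBy U (fun i => orderStatistics (a i)) P

/-- The set of `d`-dimensional increasing `U`-parking functions: those whose constituent sequences
are non-decreasing. -/
def increasingParkingFunctions {d : ℕ} (n : Fin d → ℕ) (U : (Fin d → ℕ) → Fin d → ℕ) :
    Set (∀ i, Fin (n i) → ℕ) :=
  {a | IsParkingFunction U a ∧ ∀ i, Monotone (a i)}

/-- `U = A ℕ^d + s`, that is, `u_k = A k + s` for all `k`. -/
def IsAffineNodeSet {d : ℕ} (U : (Fin d → ℕ) → Fin d → ℕ) (A : Matrix (Fin d) (Fin d) ℤ)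
    (s : Fin d → ℤ) : Prop :=
  ∀ k : Fin d → ℕ, (fun i => (U k i : ℤ)) = A.mulVec (fun j => (k j : ℤ)) + s

/-- The matrix with zero diagonal and all off-diagonal entries of column `j` equal to `α j`. -/
def offDiagColumnMatrix {d : ℕ} (α : Fin d → ℤ) : Matrix (Fin d) (Fin d) ℤ :=
  Matrix.of fun i j => if i = j then 0 else α j

/-- The upper factorial `x^{(k)}`: it is `x (x + 1) ⋯ (x + k - 1)` for `k ≥ 0`, and
`1 / ((x - 1) (x - 2) ⋯ (x - m))` for `k = -m < 0`, as forced by `x^{(k + 1)} = x^{(k)} (x + k)`. -/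
def upperFactorial (x : ℚ) : ℤ → ℚ
  | Int.ofNat k => ∏ i ∈ Finset.range k, (x + i)
  | Int.negSucc m => (∏ i ∈ Finset.range (m + 1), (x - (i + 1)))⁻¹

/-! The factorial-weighted count and the closed formula satisfy the same recursion. Choose `i` with
`n i > 0` and `U 0 i > 0`. If the least entry of the `i`-th list is positive, lower that list and
the `i`-th weights by one; if it is `0`, delete it and translate the origin by `e_i`
(`parkingLists_add_single`). With `y_j = s_j + N`, the first operation sends `y_i` to `y_i - 1` and
the second sends it to `y_i - α_i`, while every other `y_j` is fixed. The formula therefore only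
needs a one-variable difference equation (`rothe_succ_eq_add`, `shiftedRising_succ_eq_add`) and
linearity in the `i`-th slot (`polarProd_eq_add_mul`).

If no such `i` exists and `n` is nonzero, both sides vanish (`parkingLists_eq_empty`,
`countPoly_eq_zero`). Some `y_j` may be zero along the recursion, so the formula is carried in the
division-free form `countPoly`, and denominators return only in `countPoly_eq_of_ne_zero`. -/

/-- The ascending product `x (x + 1) ⋯ (x + k - 1)`. -/
def risingProd (x : ℚ) (k : ℕ) : ℚ := ∏ i ∈ Finset.range k, (x + i)

theorem risingProd_succ (x : ℚ) (k : ℕ) : risingProd x (k + 1) = risingProd x k * (x + k) :=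
  Finset.prod_range_succ _ _

theorem risingProd_succ' (x : ℚ) (k : ℕ) :
    risingProd x (k + 1) = x * risingProd (x + 1) k := by
  unfold risingProd
  rw [Finset.prod_range_succ', mul_comm]
  congr 1
  · simp
  · exact Finset.prod_congr rfl fun i _ => by push_cast; ring

/-! ### One-variable polynomials and their difference equations -/

/-- The Rothe-type polynomial `y (y - α n + 1) ⋯ (y - α n + n - 1)`, equal to `1` for `n = 0`. -/
def rothe (α y : ℚ) : ℕ → ℚ
  | 0 => 1
  | m + 1 => y * risingProd (y - α * (m + 1 : ℕ) + 1) m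

/-- The shifted ascending product `(y - α n) (y - α n + 1) ⋯ (y - α n + n - 1)`. -/
def shiftedRising (α y : ℚ) (n : ℕ) : ℚ := risingProd (y - α * n) n

theorem rothe_succ_eq_add (α y : ℚ) (m : ℕ) :
    rothe α y (m + 1) = rothe α (y - 1) (m + 1) + (m + 1) * rothe α (y - α) m := by
  cases m with
  | zero => simp [rothe, risingProd]
  | succ k =>
    simp only [rothe]
    rw [risingProd_succ]
    have e1 : y - 1 - α * ((k + 1 + 1 : ℕ) : ℚ) + 1 = y - α * ((k + 1 + 1 : ℕ) : ℚ) := by ring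
    have e2 : y - α - α * ((k + 1 : ℕ) : ℚ) + 1 = y - α * ((k + 1 + 1 : ℕ) : ℚ) + 1 := by
      push_cast; ring
    rw [e1, e2, risingProd_succ']
    push_cast
    ring

theorem shiftedRising_succ_eq_add (α y : ℚ) (m : ℕ) :
    shiftedRising α y (m + 1) =
      shiftedRising α (y - 1) (m + 1) + (m + 1) * shiftedRising α (y - α) m := by
  unfold shiftedRising
  have e2 : y - α - α * (m : ℚ) = y - α * ((m + 1 : ℕ) : ℚ) := by push_cast; ring
  rw [risingProd_succ, risingProd_succ', e2,
    show y - 1 - α * ((m + 1 : ℕ) : ℚ) + 1 = y - α * ((m + 1 : ℕ) : ℚ) by ring]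
  ring

/-- Divided by `y`, this is the source of the fractions `α_j n_j / (s_j + N)`. -/
theorem mul_rothe_sub_shiftedRising (α y : ℚ) (n : ℕ) :
    y * (rothe α y n - shiftedRising α y n) = α * n * rothe α y n := by
  cases n with
  | zero => simp [rothe, shiftedRising, risingProd]
  | succ m =>
    simp only [rothe, shiftedRising]
    rw [risingProd_succ']
    ring

theorem rothe_zero_left_of_pos (α : ℚ) {n : ℕ} (hn : 0 < n) : rothe α 0 n = 0 := by
  cases n with
  | zero => omega
  | succ m => simp [rothe]

/-! ### Polarised products -/

/-- The polarised product `∏ h - ∑ⱼ (hⱼ - vⱼ) ∏_{i ≠ j} hᵢ`. -/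
def polarProd {ι : Type*} [Fintype ι] [DecidableEq ι] (h v : ι → ℚ) : ℚ :=
  ∏ i, h i - ∑ j, (h j - v j) * ∏ i ∈ Finset.univ.erase j, h i

theorem polarProd_eq {ι : Type*} [Fintype ι] [DecidableEq ι] (h v : ι → ℚ) (i : ι) :
    polarProd h v = v i * ∏ j ∈ Finset.univ.erase i, h j -
      h i * ∑ j ∈ Finset.univ.erase i, (h j - v j) *
        ∏ l ∈ (Finset.univ.erase i).erase j, h l := by
  unfold polarProd
  rw [← Finset.mul_prod_erase Finset.univ h (Finset.mem_univ i),
    ← Finset.add_sum_erase Finset.univ (fun j => (h j - v j) * ∏ l ∈ Finset.univ.erase j, h l)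
      (Finset.mem_univ i), Finset.mul_sum]
  have : ∑ j ∈ Finset.univ.erase i, (h j - v j) * ∏ l ∈ Finset.univ.erase j, h l =
      ∑ j ∈ Finset.univ.erase i, h i * ((h j - v j) *
        ∏ l ∈ (Finset.univ.erase i).erase j, h l) := by
    refine Finset.sum_congr rfl fun j hj => ?_
    have hi : i ∈ Finset.univ.erase j :=
      Finset.mem_erase.2 ⟨(Finset.ne_of_mem_erase hj).symm, Finset.mem_univ i⟩
    rw [← Finset.mul_prod_erase _ h hi, Finset.erase_right_comm]
    ring
  rw [this]
  ring

/-- With the other slots fixed, every term is linear in the pair `(h i, v i)`, as the expansion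
`polarProd_eq` shows. -/
theorem polarProd_eq_add_mul {ι : Type*} [Fintype ι] [DecidableEq ι] (i : ι) (c : ℚ)
    {h h₁ h₂ v v₁ v₂ : ι → ℚ}
    (hh₁ : ∀ j ≠ i, h₁ j = h j) (hh₂ : ∀ j ≠ i, h₂ j = h j)
    (hv₁ : ∀ j ≠ i, v₁ j = v j) (hv₂ : ∀ j ≠ i, v₂ j = v j)
    (hh : h i = h₁ i + c * h₂ i) (hv : v i = v₁ i + c * v₂ i) :
    polarProd h v = polarProd h₁ v₁ + c * polarProd h₂ v₂ := by
  have key : ∀ h' v' : ι → ℚ, (∀ j ≠ i, h' j = h j) → (∀ j ≠ i, v' j = v j) →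
      polarProd h' v' = v' i * ∏ j ∈ Finset.univ.erase i, h j -
        h' i * ∑ j ∈ Finset.univ.erase i, (h j - v j) *
          ∏ l ∈ (Finset.univ.erase i).erase j, h l := by
    intro h' v' e1 e2
    rw [polarProd_eq h' v' i]
    congr 2
    · exact Finset.prod_congr rfl fun j hj => e1 j (Finset.ne_of_mem_erase hj)
    · refine Finset.sum_congr rfl fun j hj => ?_
      rw [e1 j (Finset.ne_of_mem_erase hj), e2 j (Finset.ne_of_mem_erase hj)]
      congr 1
      exact Finset.prod_congr rfl fun l hl =>
        e1 l (Finset.ne_of_mem_erase (Finset.mem_of_mem_erase hl))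
  rw [key h v (fun _ _ => rfl) (fun _ _ => rfl), key h₁ v₁ hh₁ hv₁, key h₂ v₂ hh₂ hv₂, hh, hv]
  ring

theorem polarProd_eq_mul_prod {ι : Type*} [Fintype ι] [DecidableEq ι] {h v c : ι → ℚ}
    (hc : ∀ j, h j - v j = c j * h j) : polarProd h v = (1 - ∑ j, c j) * ∏ i, h i := by
  unfold polarProd
  rw [sub_mul, one_mul, Finset.sum_mul]
  congr 1
  refine Finset.sum_congr rfl fun j _ => ?_
  rw [hc, mul_assoc, Finset.mul_prod_erase _ h (Finset.mem_univ j)]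

/-! ### The closed formula: recursion, vanishing, and form with denominators -/

/-- The numerator `𝐧! · #IPF` of the counting formula, for nodes with slopes `α` and offset `s`. -/
def countPoly {d : ℕ} (α s : Fin d → ℤ) (n : Fin d → ℕ) : ℚ :=
  polarProd (fun i => rothe (α i) ((s i + ∑ j, α j * (n j : ℤ) : ℤ) : ℚ) (n i))
    (fun i => shiftedRising (α i) ((s i + ∑ j, α j * (n j : ℤ) : ℤ) : ℚ) (n i))

theorem sum_mul_add_single {d : ℕ} (α : Fin d → ℤ) (n : Fin d → ℕ) (i : Fin d) :
    ∑ j, α j * ((n + Pi.single i 1 : Fin d → ℕ) j : ℤ) = ∑ j, α j * (n j : ℤ) + α i := by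
  have : ∀ j, α j * ((n + Pi.single i 1 : Fin d → ℕ) j : ℤ) =
      α j * (n j : ℤ) + if j = i then α j else 0 := by
    intro j
    by_cases hj : j = i
    · subst hj; simp; ring
    · simp [hj]
  rw [Finset.sum_congr rfl fun j _ => this j]
  simp [Finset.sum_add_distrib]

theorem countPoly_add_single {d : ℕ} (α s : Fin d → ℤ) (n : Fin d → ℕ) (i : Fin d) :
    countPoly α s (n + Pi.single i 1) =
      countPoly α (s - Pi.single i 1) (n + Pi.single i 1) +
        (n i + 1) * countPoly α (s + fun j => if j = i then 0 else α i) n := by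
  unfold countPoly
  rw [sum_mul_add_single]
  refine polarProd_eq_add_mul i _ ?_ ?_ ?_ ?_ ?_ ?_
  · intro j hj; simp [hj]
  · intro j hj; simp [hj]; congr 1; ring
  · intro j hj; simp [hj]
  · intro j hj; simp [hj]; congr 1; ring
  · have := rothe_succ_eq_add (α i) ((s i + (∑ j, α j * (n j : ℤ) + α i) : ℤ) : ℚ) (n i)
    simp only [Pi.add_apply, Pi.sub_apply, Pi.single_eq_same, if_true, add_zero] at this ⊢
    rw [this]
    congr 2
    · push_cast; ring
    · congr 1; push_cast; ring
  · have := shiftedRising_succ_eq_add (α i) ((s i + (∑ j, α j * (n j : ℤ) + α i) : ℤ) : ℚ) (n i)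
    simp only [Pi.add_apply, Pi.sub_apply, Pi.single_eq_same, if_true, add_zero] at this ⊢
    rw [this]
    congr 2
    · push_cast; ring
    · congr 1; push_cast; ring

/-- On the support of `n` all `y_j` equal `N`, so for `N ≠ 0` the factor `1 - ∑ α_j n_j / N` is
zero. -/
theorem countPoly_eq_zero {d : ℕ} {α s : Fin d → ℤ} {n : Fin d → ℕ}
    (hs : ∀ i, 0 < n i → s i = 0) {p : Fin d} (hp : 0 < n p) : countPoly α s n = 0 := by
  set N : ℤ := ∑ j, α j * (n j : ℤ) with hN
  have hmul : ∀ j, (N : ℚ) * (rothe (α j) ((s j + N : ℤ) : ℚ) (n j) -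
      shiftedRising (α j) ((s j + N : ℤ) : ℚ) (n j)) =
        α j * n j * rothe (α j) ((s j + N : ℤ) : ℚ) (n j) := by
    intro j
    rcases Nat.eq_zero_or_pos (n j) with h0 | h0
    · simp [h0, rothe, shiftedRising, risingProd]
    · rw [hs j h0, zero_add]; exact mul_rothe_sub_shiftedRising _ _ _
  by_cases h0 : N = 0
  -- For `N = 0` each Rothe factor on the support vanishes. Two such indices kill every term; a lone
  -- index `p` forces `α p = 0`, which kills the shifted product too.
  · have hz : ∀ j, 0 < n j → rothe (α j) ((s j + N : ℤ) : ℚ) (n j) = 0 := by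
      intro j hj
      rw [hs j hj, h0]; simpa using rothe_zero_left_of_pos (α j) hj
    unfold countPoly
    rw [← hN, polarProd_eq _ _ p]
    simp only [hz p hp, zero_mul, sub_zero]
    by_cases hq : ∃ q ≠ p, 0 < n q
    · obtain ⟨q, hqp, hq⟩ := hq
      rw [Finset.prod_eq_zero (Finset.mem_erase.2 ⟨hqp, Finset.mem_univ q⟩) (hz q hq), mul_zero]
    · push Not at hq
      have hNp : N = α p * n p := by
        rw [hN]
        refine Finset.sum_eq_single p (fun b _ hb => ?_) (by simp)
        have := hq b hb
        simp [Nat.le_zero.1 this]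
      have hαp : α p = 0 := by
        rw [h0] at hNp
        rcases mul_eq_zero.1 hNp.symm with h | h
        · exact h
        · omega
      obtain ⟨m, hm⟩ : ∃ m, n p = m + 1 := ⟨n p - 1, by omega⟩
      have : shiftedRising (α p) ((s p + N : ℤ) : ℚ) (n p) = 0 := by
        rw [hs p hp, h0, hαp, shiftedRising, hm, risingProd_succ']
        simp
      rw [this, zero_mul]
  · have hN0 : (N : ℚ) ≠ 0 := by exact_mod_cast h0
    unfold countPoly
    rw [← hN, polarProd_eq_mul_prod (c := fun j => (α j * n j : ℚ) / N)]
    · rw [← Finset.sum_div]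
      have : ∑ j, (α j * n j : ℚ) = N := by rw [hN]; push_cast; rfl
      rw [this, div_self hN0]; simp
    · intro j
      rw [div_mul_eq_mul_div, eq_div_iff hN0, ← hmul j]; ring

theorem mul_upperFactorial_eq_rothe (α y : ℚ) (hy : y ≠ 0) (n : ℕ) :
    y * upperFactorial (y - α * n + 1) ((n : ℤ) - 1) = rothe α y n := by
  cases n with
  | zero =>
    -- Here the convention `x^{(-1)} = 1/(x - 1)` at `x = y + 1` gives `1/y`, which cancels the
    -- prefactor.
    have : ((0 : ℕ) : ℤ) - 1 = Int.negSucc 0 := rfl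
    rw [this]
    simp [upperFactorial, rothe, hy]
  | succ m =>
    have : ((m + 1 : ℕ) : ℤ) - 1 = Int.ofNat m := by simp
    rw [this]
    rfl

theorem countPoly_eq_of_ne_zero {d : ℕ} {α s : Fin d → ℤ} {n : Fin d → ℕ} {N : ℤ}
    (hN : N = ∑ i, α i * (n i : ℤ)) (hden : ∀ j, s j + N ≠ 0) :
    countPoly α s n =
      (1 - ∑ j, ((α j : ℚ) * (n j : ℚ)) / ((s j : ℚ) + (N : ℚ))) *
        ∏ i, (((s i : ℚ) + (N : ℚ)) *
          upperFactorial ((s i : ℚ) + (N : ℚ) - (α i : ℚ) * (n i : ℚ) + 1) ((n i : ℤ) - 1)) := by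
  have hden' : ∀ j, (s j : ℚ) + (N : ℚ) ≠ 0 := fun j => by exact_mod_cast hden j
  unfold countPoly
  rw [← hN, polarProd_eq_mul_prod (c := fun j => ((α j : ℚ) * (n j : ℚ)) / ((s j : ℚ) + (N : ℚ)))]
  · congr 1
    refine Finset.prod_congr rfl fun i _ => ?_
    rw [mul_upperFactorial_eq_rothe _ _ (hden' i)]
    push_cast; rfl
  · intro j
    rw [div_mul_eq_mul_div, eq_div_iff (hden' j), mul_comm]
    have := mul_rothe_sub_shiftedRising (α j) ((s j + N : ℤ) : ℚ) (n j)
    push_cast at this ⊢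
    exact this

/-! ### Bounding paths in recursive form -/

/-- The tuple of lists `l` is bounded, with respect to the weights `U`, by the lattice path with
the given step directions, and is exhausted by it. -/
def PathBounds {d : ℕ} :
    List (Fin d) → ((Fin d → ℕ) → Fin d → ℕ) → (Fin d → List ℕ) → Prop
  | [], _, l => ∀ i, l i = []
  | j :: p, U, l => ∃ x t, l j = x :: t ∧ x < U 0 j ∧
      PathBounds p (fun k => U (k + Pi.single j 1)) (Function.update l j t)

theorem count_cons_eq_add_single {d : ℕ} (j : Fin d) (p : List (Fin d)) :
    (fun i => (j :: p).count i) = (fun i => p.count i) + Pi.single j 1 := by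
  funext i
  by_cases h : i = j
  · subst h; simp
  · simp [h, Ne.symm h]

/-- The recursion translates the weights and drops list heads where the indexed form moves along the
path. -/
theorem pathBounds_iff {d : ℕ} (p : List (Fin d)) :
    ∀ (U : (Fin d → ℕ) → Fin d → ℕ) (l : Fin d → List ℕ),
      PathBounds p U l ↔ (∀ i, p.count i = (l i).length) ∧
        ∀ (r : ℕ) (hr : r < p.length), ∃ x, (l p[r])[(p.take r).count p[r]]? = some x ∧
          x < U (fun i => (p.take r).count i) p[r] := by
  induction p with
  | nil =>
    intro U l
    simp [PathBounds, eq_comm]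
  | cons j p ih =>
    intro U l
    have step : ∀ x t, l j = x :: t → ∀ (r : ℕ) (hr : r < p.length),
        (Function.update l j t p[r])[(p.take r).count p[r]]? =
          (l p[r])[((j :: p).take (r + 1)).count p[r]]? := by
      intro x t hl r hr
      have hc := congrFun (count_cons_eq_add_single j (p.take r)) p[r]
      rw [List.take_succ_cons, hc]
      by_cases h : p[r] = j
      · simp [h, hl]
      · simp [h]
    simp only [PathBounds, ih]
    constructor
    · rintro ⟨x, t, hl, hx, hcount, hb⟩
      refine ⟨fun i => ?_, fun r hr => ?_⟩
      · have hc := congrFun (count_cons_eq_add_single j p) i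
        simp only [Pi.add_apply] at hc
        rw [hc, hcount]
        by_cases h : i = j
        · subst h; simp [hl]
        · simp [h]
      · cases r with
        | zero => exact ⟨x, by simp [hl], by simpa [← Pi.zero_def] using hx⟩
        | succ r =>
          have hr' : r < p.length := by simpa using hr
          obtain ⟨y, hy, hyU⟩ := hb r hr'
          refine ⟨y, (step x t hl r hr') ▸ hy, ?_⟩
          simp only [List.take_succ_cons, List.getElem_cons_succ]
          rw [count_cons_eq_add_single]
          exact hyU
    · rintro ⟨hcount, hb⟩
      obtain ⟨x, hx, hxU⟩ := hb 0 (by simp)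
      simp only [List.getElem_cons_zero, List.take_zero, List.count_nil] at hx hxU
      obtain ⟨t, hl⟩ : ∃ t, l j = x :: t := by
        cases h : l j with
        | nil => simp [h] at hx
        | cons y t => simp [h] at hx; exact ⟨t, by rw [hx]⟩
      refine ⟨x, t, hl, hxU, fun i => ?_, fun r hr => ?_⟩
      · have hc := congrFun (count_cons_eq_add_single j p) i
        simp only [Pi.add_apply] at hc
        have := hcount i
        rw [hc] at this
        by_cases h : i = j
        · subst h; simpa [hl] using this
        · simpa [h] using this
      · obtain ⟨y, hy, hyU⟩ := hb (r + 1) (by simpa using hr)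
        refine ⟨y, (step x t hl r hr) ▸ hy, ?_⟩
        simp only [List.take_succ_cons, List.getElem_cons_succ] at hyU
        rwa [count_cons_eq_add_single] at hyU

/-- Add the vector `c` to all entries of a tuple of lists. -/
def raiseBy {d : ℕ} (c : Fin d → ℕ) (l : Fin d → List ℕ) : Fin d → List ℕ :=
  fun i => (l i).map (· + c i)

/-- Prepend `0` to the `i`-th list. -/
def consZero {d : ℕ} (i : Fin d) (l : Fin d → List ℕ) : Fin d → List ℕ :=
  Function.update l i (0 :: l i)

theorem raiseBy_update {d : ℕ} (c : Fin d → ℕ) (l : Fin d → List ℕ) (j : Fin d) (t : List ℕ) :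
    raiseBy c (Function.update l j t) =
      Function.update (raiseBy c l) j (t.map (· + c j)) := by
  funext i
  by_cases h : i = j
  · subst h; simp [raiseBy]
  · simp [raiseBy, h]

theorem pathBounds_raiseBy {d : ℕ} (c : Fin d → ℕ) (p : List (Fin d)) :
    ∀ (V : (Fin d → ℕ) → Fin d → ℕ) (l : Fin d → List ℕ),
      PathBounds p (fun k => V k + c) (raiseBy c l) ↔ PathBounds p V l := by
  induction p with
  | nil => intro V l; simp [PathBounds, raiseBy]
  | cons j p ih =>
    intro V l
    simp only [PathBounds]
    constructor
    · rintro ⟨x, t, hl, hx, hp⟩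
      obtain ⟨y, u, hl', rfl, rfl⟩ := List.map_eq_cons_iff.1 hl
      refine ⟨y, u, hl', by simpa using hx, ?_⟩
      rw [← raiseBy_update] at hp
      exact (ih _ _).1 hp
    · rintro ⟨x, t, hl, hx, hp⟩
      refine ⟨x + c j, t.map (· + c j), by simp [raiseBy, hl], by simpa using hx, ?_⟩
      rw [← raiseBy_update]
      exact (ih _ _).2 hp

/-- Move the first `i`-step to the front of the path: the steps it overtakes now start one unit
further in direction `i`, where monotone weights are at least as large. -/
theorem exists_pathBounds_of_cons {d : ℕ} (i : Fin d) (p : List (Fin d)) :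
    ∀ (U : (Fin d → ℕ) → Fin d → ℕ) (l : Fin d → List ℕ) (x : ℕ) (t : List ℕ), Monotone U →
      l i = x :: t → PathBounds p U l →
        ∃ q, PathBounds q (fun k => U (k + Pi.single i 1)) (Function.update l i t) := by
  induction p with
  | nil => intro U l x t _ hl h; simp [h i] at hl
  | cons j p ih =>
    rintro U l x t hU hl ⟨y, u, hj, hy, hp⟩
    by_cases hij : j = i
    · subst hij
      rw [hl] at hj
      obtain ⟨rfl, rfl⟩ := List.cons_eq_cons.1 hj
      exact ⟨p, hp⟩
    · obtain ⟨q, hq⟩ := ih _ _ x t (fun a b hab => hU (add_le_add_left hab _))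
        (by rw [Function.update_of_ne (Ne.symm hij), hl]) hp
      refine ⟨j :: q, y, u, by rw [Function.update_of_ne hij, hj],
        hy.trans_le (hU (zero_le) j), ?_⟩
      rw [Function.update_comm (Ne.symm hij)]
      convert hq using 3
      ac_rfl

/-! ### Recursion for the sets of bounded tuples -/

/-- Tuples of sorted lists of lengths `n` that are bounded by some lattice path. -/
def parkingLists {d : ℕ} (n : Fin d → ℕ) (U : (Fin d → ℕ) → Fin d → ℕ) :
    Set (Fin d → List ℕ) :=
  {l | (∀ i, (l i).length = n i ∧ (l i).Pairwise (· ≤ ·)) ∧ ∃ p, PathBounds p U l}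

theorem parkingLists_zero {d : ℕ} (U : (Fin d → ℕ) → Fin d → ℕ) :
    parkingLists 0 U = {fun _ => []} := by
  ext l
  simp only [parkingLists, Set.mem_ofPred_eq, Set.mem_singleton_iff]
  constructor
  · rintro ⟨h, -⟩
    funext i
    simpa using (h i).1
  · rintro rfl
    exact ⟨fun i => by simp, [], fun i => rfl⟩

/-- The first step of a bounding path would need an entry below `0`. -/
theorem parkingLists_eq_empty {d : ℕ} {n : Fin d → ℕ} {U : (Fin d → ℕ) → Fin d → ℕ}
    (hU : ∀ i, 0 < n i → U 0 i = 0) {p : Fin d} (hp : 0 < n p) : parkingLists n U = ∅ := by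
  refine Set.eq_empty_of_forall_notMem ?_
  rintro l ⟨hl, q, hq⟩
  cases q with
  | nil =>
    have := (hl p).1
    rw [hq p] at this
    simp at this
    omega
  | cons j q =>
    obtain ⟨x, t, hj, hx, -⟩ := hq
    have h1 := (hl j).1
    rw [hj] at h1
    simp at h1
    rw [hU j (by omega)] at hx
    omega

theorem raiseBy_injective {d : ℕ} (c : Fin d → ℕ) : Function.Injective (raiseBy c) := by
  intro l m h
  funext i
  exact List.map_injective_iff.2 (add_left_injective (c i)) (congrFun h i)

theorem consZero_injective {d : ℕ} (i : Fin d) : Function.Injective (consZero i) := by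
  intro l m h
  funext j
  have := congrFun h j
  by_cases hj : j = i
  · subst hj; simpa [consZero] using this
  · simpa [consZero, hj] using this

theorem exists_map_add_one {t : List ℕ} (h : ∀ x ∈ t, 0 < x) :
    ∃ u : List ℕ, t = u.map (· + 1) := by
  refine ⟨t.map (· - 1), ?_⟩
  rw [List.map_map]
  conv_lhs => rw [← List.map_id t]
  refine List.map_congr_left fun x hx => ?_
  have := h x hx
  simp
  omega

theorem parkingLists_add_single {d : ℕ} (n : Fin d → ℕ) (V : (Fin d → ℕ) → Fin d → ℕ)
    (hV : Monotone V) (i : Fin d) :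
    parkingLists (n + Pi.single i 1) (fun k => V k + Pi.single i 1) =
      raiseBy (Pi.single i 1) '' parkingLists (n + Pi.single i 1) V ∪
      consZero i '' parkingLists n (fun k => V (k + Pi.single i 1) + Pi.single i 1) := by
  ext l
  constructor
  · rintro ⟨hl, p, hp⟩
    obtain ⟨x, t, hi⟩ : ∃ x t, l i = x :: t := by
      have := (hl i).1
      cases h : l i with
      | nil => simp [h] at this
      | cons x t => exact ⟨x, t, rfl⟩
    have hs := (hl i).2
    rw [hi, List.pairwise_cons] at hs
    rcases Nat.eq_zero_or_pos x with rfl | hx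
    · right
      obtain ⟨q, hq⟩ := exists_pathBounds_of_cons i p _ l 0 t
        (fun a b hab => add_le_add_left (hV hab) _) hi hp
      refine ⟨Function.update l i t, ⟨fun j => ?_, q, hq⟩, ?_⟩
      · by_cases hj : j = i
        · subst hj
          have := (hl j).1
          rw [hi] at this
          simp at this
          simpa using ⟨this, hs.2⟩
        · simpa [hj] using hl j
      · unfold consZero
        simp [← hi]
    · left
      obtain ⟨u, hu⟩ := exists_map_add_one (t := l i) (by
        rw [hi]
        intro y hy
        rcases List.mem_cons.1 hy with rfl | hy
        · exact hx
        · exact hx.trans_le (hs.1 y hy))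
      have hr : raiseBy (Pi.single i 1) (Function.update l i u) = l := by
        funext j
        by_cases hj : j = i
        · subst hj; simp [raiseBy, hu]
        · simp [raiseBy, hj]
      refine ⟨Function.update l i u, ⟨fun j => ?_, p, ?_⟩, hr⟩
      · by_cases hj : j = i
        · subst hj
          have := hl j
          rw [hu, List.pairwise_map] at this
          simpa using this
        · simpa [hj] using hl j
      · rw [← pathBounds_raiseBy (Pi.single i 1), hr]
        exact hp
  · rintro (⟨m, ⟨hm, p, hp⟩, rfl⟩ | ⟨m, ⟨hm, p, hp⟩, rfl⟩)
    · refine ⟨fun j => ?_, p, (pathBounds_raiseBy _ _ _ _).2 hp⟩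
      have := hm j
      simpa [raiseBy, List.pairwise_map] using this
    · refine ⟨fun j => ?_, i :: p, 0, m i, by simp [consZero], by simp, ?_⟩
      · by_cases hj : j = i
        · subst hj
          have := hm j
          simpa [consZero] using this
        · simpa [consZero, hj] using hm j
      · simpa [consZero] using hp

theorem disjoint_raiseBy_consZero {d : ℕ} (i : Fin d) (S T : Set (Fin d → List ℕ)) :
    Disjoint (raiseBy (Pi.single i 1) '' S) (consZero i '' T) := by
  rw [Set.disjoint_left]
  rintro _ ⟨l, -, rfl⟩ ⟨m, -, h⟩
  have := congrFun h i
  simp only [consZero, raiseBy, Function.update_self, Pi.single_eq_same] at this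
  obtain ⟨x, _, _, h1, _⟩ := List.map_eq_cons_iff.1 this.symm
  omega

theorem parkingLists_add_single_ncard {d : ℕ} (n : Fin d → ℕ) (V : (Fin d → ℕ) → Fin d → ℕ)
    (hV : Monotone V) (i : Fin d) (h₁ : (parkingLists (n + Pi.single i 1) V).Finite)
    (h₂ : (parkingLists n (fun k => V (k + Pi.single i 1) + Pi.single i 1)).Finite) :
    (parkingLists (n + Pi.single i 1) (fun k => V k + Pi.single i 1)).Finite ∧
    (parkingLists (n + Pi.single i 1) (fun k => V k + Pi.single i 1)).ncard =
      (parkingLists (n + Pi.single i 1) V).ncard +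
        (parkingLists n (fun k => V (k + Pi.single i 1) + Pi.single i 1)).ncard := by
  rw [parkingLists_add_single n V hV i]
  refine ⟨(h₁.image _).union (h₂.image _), ?_⟩
  rw [Set.ncard_union_eq (disjoint_raiseBy_consZero i _ _) (h₁.image _) (h₂.image _),
    Set.ncard_image_of_injective _ (raiseBy_injective _),
    Set.ncard_image_of_injective _ (consZero_injective i)]

/-! ### From functions to lists -/

theorem image_ofFn_increasingParkingFunctions {d : ℕ} (n : Fin d → ℕ)
    (U : (Fin d → ℕ) → Fin d → ℕ) :
    (fun (a : ∀ i, Fin (n i) → ℕ) i => List.ofFn (a i)) '' increasingParkingFunctions n U =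
      parkingLists n U := by
  have key : ∀ a : ∀ i, Fin (n i) → ℕ, (∀ i, Monotone (a i)) →
      (IsParkingFunction U a ↔ ∃ p, PathBounds p U (fun i => List.ofFn (a i))) := by
    intro a ha
    have ho : (fun i => orderStatistics (a i)) = a := by
      funext i
      rw [orderStatistics, Tuple.sort_eq_refl_iff_monotone.2 (ha i)]
      rfl
    unfold IsParkingFunction
    rw [ho]
    constructor
    · rintro ⟨P, hP⟩
      refine ⟨P.steps, (pathBounds_iff _ _ _).2 ⟨fun i => by simp [P.count_eq], fun r hr => ?_⟩⟩
      refine ⟨_, ?_, hP r hr⟩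
      have : (P.steps.take r).count P.steps[r] < n P.steps[r] := P.pos_lt r hr
      rw [List.getElem?_eq_getElem (by simpa using this), List.getElem_ofFn]
      rfl
    · rintro ⟨p, hp⟩
      obtain ⟨hc, hb⟩ := (pathBounds_iff _ _ _).1 hp
      refine ⟨⟨p, fun i => by simpa using hc i⟩, fun r hr => ?_⟩
      obtain ⟨x, hx, hxU⟩ := hb r hr
      obtain ⟨hlt, rfl⟩ := List.getElem?_eq_some_iff.1 hx
      rw [List.getElem_ofFn] at hxU
      exact hxU
  ext l
  constructor
  · rintro ⟨a, ⟨h1, h2⟩, rfl⟩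
    exact ⟨fun i => ⟨by simp, (List.sortedLE_ofFn_iff.2 (h2 i)).pairwise⟩, (key a h2).1 h1⟩
  · rintro ⟨hl, hp⟩
    have : ∃ a : ∀ i, Fin (n i) → ℕ, (fun i => List.ofFn (a i)) = l := by
      refine ⟨fun i j => (l i)[j]'(by rw [(hl i).1]; exact j.2), ?_⟩
      funext i
      refine List.ext_getElem (by simp [(hl i).1]) fun k h1 h2 => by simp
    obtain ⟨a, rfl⟩ := this
    have hm : ∀ i, Monotone (a i) := fun i => List.sortedLE_ofFn_iff.1 (hl i).2.sortedLE
    exact ⟨a, ⟨(key a hm).2 hp, hm⟩, rfl⟩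

theorem ofFn_tuple_injective {d : ℕ} (n : Fin d → ℕ) :
    Function.Injective (fun (a : ∀ i, Fin (n i) → ℕ) i => List.ofFn (a i)) := by
  intro a b h
  funext i
  exact List.ofFn_injective (congrFun h i)

/-! ### Affine weights under the two operations -/

theorem isAffineNodeSet_iff {d : ℕ} {U : (Fin d → ℕ) → Fin d → ℕ} {α s : Fin d → ℤ} :
    IsAffineNodeSet U (offDiagColumnMatrix α) s ↔
      ∀ k i, (U k i : ℤ) = ∑ j, (if i = j then 0 else α j) * (k j : ℤ) + s i := by
  unfold IsAffineNodeSet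
  refine forall_congr' fun k => ?_
  rw [funext_iff]
  rfl

theorem isAffineNodeSet_sub_single {d : ℕ} {V : (Fin d → ℕ) → Fin d → ℕ} {α s : Fin d → ℤ}
    {i : Fin d}
    (h : IsAffineNodeSet (fun k => V k + Pi.single i 1) (offDiagColumnMatrix α) s) :
    IsAffineNodeSet V (offDiagColumnMatrix α) (s - Pi.single i 1) := by
  rw [isAffineNodeSet_iff] at h ⊢
  intro k j
  have := h k j
  by_cases hj : j = i
  · subst hj; simp at this ⊢; linarith
  · simp [hj] at this ⊢; linarith

theorem isAffineNodeSet_shift {d : ℕ} {U : (Fin d → ℕ) → Fin d → ℕ} {α s : Fin d → ℤ}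
    (h : IsAffineNodeSet U (offDiagColumnMatrix α) s) (i : Fin d) :
    IsAffineNodeSet (fun k => U (k + Pi.single i 1)) (offDiagColumnMatrix α)
      (s + fun j => if j = i then 0 else α i) := by
  rw [isAffineNodeSet_iff] at h ⊢
  intro k j
  rw [h, sum_mul_add_single (fun l => if j = l then 0 else α l) k i, Pi.add_apply]
  ring

theorem prod_factorial_add_single {d : ℕ} (n : Fin d → ℕ) (i : Fin d) :
    ∏ j, (((n + Pi.single i 1 : Fin d → ℕ) j).factorial : ℚ) =
      (n i + 1) * ∏ j, ((n j).factorial : ℚ) := by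
  have : ∀ j, (((n + Pi.single i 1 : Fin d → ℕ) j).factorial : ℚ) =
      (if j = i then (n i + 1 : ℚ) else 1) * ((n j).factorial : ℚ) := by
    intro j
    by_cases hj : j = i
    · subst hj; simp [Nat.factorial_succ]
    · simp [hj]
  rw [Finset.prod_congr rfl fun j _ => this j, Finset.prod_mul_distrib]
  simp

theorem exists_add_single {d : ℕ} {n : Fin d → ℕ} {i : Fin d} (h : 0 < n i) :
    ∃ m : Fin d → ℕ, n = m + Pi.single i 1 := by
  refine ⟨fun j => n j - (Pi.single i 1 : Fin d → ℕ) j, ?_⟩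
  funext j
  by_cases hj : j = i
  · subst hj; simp; omega
  · simp [hj]

theorem exists_monotone_add_single {d : ℕ} {U : (Fin d → ℕ) → Fin d → ℕ} (hU : Monotone U)
    {i : Fin d} (h : 0 < U 0 i) :
    ∃ V : (Fin d → ℕ) → Fin d → ℕ, Monotone V ∧ U = fun k => V k + Pi.single i 1 := by
  have hpos : ∀ k, 0 < U k i := fun k => h.trans_le (hU (zero_le) i)
  choose V hV using fun k => exists_add_single (hpos k)
  refine ⟨V, fun a b hab => ?_, funext hV⟩
  have := hU hab
  rw [hV a, hV b] at this
  exact le_of_add_le_add_right this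

/-- Lexicographic induction on `(∑ n i, ∑ U 0 i)`: lowering decreases the second entry, while
deletion may increase it but decreases the first. -/
theorem prod_factorial_mul_ncard_parkingLists {d : ℕ} (α : Fin d → ℤ) (M : ℕ) :
    ∀ (K : ℕ) (n : Fin d → ℕ) (s : Fin d → ℤ) (U : (Fin d → ℕ) → Fin d → ℕ), Monotone U →
      IsAffineNodeSet U (offDiagColumnMatrix α) s → ∑ i, n i = M → ∑ i, U 0 i = K →
        (parkingLists n U).Finite ∧
          (∏ i, ((n i).factorial : ℚ)) * ((parkingLists n U).ncard : ℚ) = countPoly α s n := by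
  induction M with
  | zero =>
    intro K n s U _ _ hn _
    have h0 : n = 0 := funext fun i => (Finset.sum_eq_zero_iff.1 hn) i (Finset.mem_univ i)
    subst h0
    rw [parkingLists_zero]
    refine ⟨Set.finite_singleton _, ?_⟩
    simp [countPoly, polarProd, rothe, shiftedRising, risingProd]
  | succ M ihM =>
    intro K
    induction K with
    | zero =>
      intro n s U _ hU hn hK
      have hU0 : ∀ i, U 0 i = 0 := fun i => (Finset.sum_eq_zero_iff.1 hK) i (Finset.mem_univ i)
      obtain ⟨p, hp⟩ : ∃ p, 0 < n p := by
        by_contra! h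
        simp [fun i => Nat.le_zero.1 (h i)] at hn
      rw [parkingLists_eq_empty (fun i _ => hU0 i) hp, countPoly_eq_zero (fun i _ => ?_) hp]
      · simp
      · have := isAffineNodeSet_iff.1 hU 0 i
        simpa [hU0] using this.symm
    | succ K ihK =>
      intro n s U hmono hU hn hK
      by_cases hex : ∃ i, 0 < n i ∧ 0 < U 0 i
      · obtain ⟨i, hni, hUi⟩ := hex
        obtain ⟨m, rfl⟩ := exists_add_single hni
        obtain ⟨V, hV, rfl⟩ := exists_monotone_add_single hmono hUi
        have hm : ∑ j, m j = M := by
          simpa [Finset.sum_add_distrib] using hn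
        have hK' : ∑ j, V 0 j = K := by
          simpa [Finset.sum_add_distrib] using hK
        obtain ⟨f1, c1⟩ := ihK (m + Pi.single i 1) _ V hV (isAffineNodeSet_sub_single hU) hn hK'
        obtain ⟨f2, c2⟩ := ihM _ m _ (fun k => V (k + Pi.single i 1) + Pi.single i 1)
          (fun a b hab => hmono (add_le_add_left hab _)) (isAffineNodeSet_shift hU i) hm rfl
        obtain ⟨f, c⟩ := parkingLists_add_single_ncard m V hV i f1 f2
        refine ⟨f, ?_⟩
        rw [c, countPoly_add_single, ← c1, ← c2, prod_factorial_add_single]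
        push_cast
        ring
      · push Not at hex
        have hU0 : ∀ i, 0 < n i → U 0 i = 0 := fun i hi => Nat.le_zero.1 (hex i hi)
        obtain ⟨p, hp⟩ : ∃ p, 0 < n p := by
          by_contra! h
          simp [fun i => Nat.le_zero.1 (h i)] at hn
        rw [parkingLists_eq_empty hU0 hp, countPoly_eq_zero (fun i hi => ?_) hp]
        · simp
        · have := isAffineNodeSet_iff.1 hU 0 i
          simpa [hU0 i hi] using this.symm

theorem corollary18 (d : ℕ) (n : Fin d → ℕ) (α s : Fin d → ℤ)
    (U : (Fin d → ℕ) → Fin d → ℕ)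
    (hmono : Monotone U)
    (hU : IsAffineNodeSet U (offDiagColumnMatrix α) s)
    (N : ℤ) (hN : N = ∑ i, α i * (n i : ℤ))
    (hden : ∀ j, s j + N ≠ 0) :
    (increasingParkingFunctions n U).Finite ∧
    ((increasingParkingFunctions n U).ncard : ℚ) =
      1 / (∏ i, ((n i).factorial : ℚ)) *
        (1 - ∑ j, ((α j : ℚ) * (n j : ℚ)) / ((s j : ℚ) + (N : ℚ))) *
        ∏ i, (((s i : ℚ) + (N : ℚ)) *
          upperFactorial ((s i : ℚ) + (N : ℚ) - (α i : ℚ) * (n i : ℚ) + 1) ((n i : ℤ) - 1)) := by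
  obtain ⟨hfin, hcard⟩ :=
    prod_factorial_mul_ncard_parkingLists α _ _ n s U hmono hU rfl rfl
  have hfact : (∏ i, ((n i).factorial : ℚ)) ≠ 0 :=
    Finset.prod_ne_zero_iff.2 fun i _ => by exact_mod_cast (n i).factorial_ne_zero
  rw [← image_ofFn_increasingParkingFunctions] at hfin hcard
  rw [Set.ncard_image_of_injective _ (ofFn_tuple_injective n), countPoly_eq_of_ne_zero hN hden]
    at hcard
  refine ⟨hfin.of_finite_image (ofFn_tuple_injective n).injOn, ?_⟩
  rw [mul_assoc, ← hcard, one_div, inv_mul_cancel_left₀ hfact]
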